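/- Let $G$ be a finite group and let $H$ be a normal subgroup of $G$ such that $G/H$ is cyclic; put $n=|G/H|$. For each divisor $c$ of $n$, let $K_c$ be the unique subgroup of $G$ containing $H$ as a subgroup of index $c$, let $\Gamma_c$ be any coset of $H$ which has order $c$ as an element of $G/H$, let $T_c$ be the number of conjugacy classes of $G$ contained in $\Gamma_c$, and let $S_c$ be the number of conjugacy classes of $G$ contained in $K_c$. For a divisor $d$ of $n$, let $S^*_d$ be the number of conjugacy classes of the group $K_d$ (under its own conjugation action). Then, for every divisor $d$ of $n$, $$S^*_d=n\sum_{c\mid n}\ \sum_{a\mid c}\mu(c/a)\,\frac{\gcd(a,d)}{\operatorname{lcm}(a,d)}\,T_c$$ and $$S^*_d=n\sum_{c\mid n}\ \sum_{a\mid c}\ \sum_{b\mid c}\frac{\mu(c/a)\,\mu(c/b)}{\phi(c)}\,\frac{\gcd(a,d)}{\operatorname{lcm}(a,d)}\,S_b,$$ where $\mu$ is the Möbius function and $\phi$ is Euler's totient function. -/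

import Mathlib

/-- The number of conjugacy classes of `G` that are contained in the subset `X` of `G`. -/
noncomputable def numClassesIn {G : Type*} [Group G] (X : Set G) : ℕ :=
  {C : ConjClasses G | C.carrier ⊆ X}.ncard

/-- The coset `q` of `H` in `G`, as a subset of `G`. -/
def cosetSet {G : Type*} [Group G] (H : Subgroup G) (q : G ⧸ H) : Set G :=
  {g : G | (QuotientGroup.mk g : G ⧸ H) = q}

/-! All the class numbers are counts of commuting pairs (Burnside). Let `P α β` count the commuting
pairs in the product of two cosets. The substitution `(x, y) ↦ (x, x * y)` and the Euclidean
algorithm reduce `P α β` to `P γ 1` with `γ` generating `⟨α, β⟩`. Powers prime to `|G|` show that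
only the order of `γ` matters (`cosetCommCount_eq_of_orderOf_eq_lcm`), so `P α β = p (lcm (orderOf
α) (orderOf β))`.

Write `p k = ∑ r e` over `k ∣ e ∣ n`. Since `lcm i j ∣ e` iff `i ∣ e` and `j ∣ e`, double sums of
`P` factor for each `e` (`sum_sum_lcm_orderOf`): `n |H| T_c = ∑ e * r e` over `c ∣ e ∣ n`, and `d
|H| S*_d = ∑ gcd(e, d)² * r e` over `e ∣ n`. As `gcd(e, d)² = d * e * gcd(e, d) / lcm(e, d)`, Möbius
inversion of `gcd / lcm` in `e` gives the first formula. Inverting `S_b = ∑ φ(k) T_k` over `k ∣ b`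
gives the second. -/

open Finset

/-- The number of commuting pairs in `X × Y`. -/
noncomputable def commCount {G : Type*} [Group G] (X Y : Set G) : ℕ :=
  Nat.card {p : G × G // p.1 ∈ X ∧ p.2 ∈ Y ∧ Commute p.1 p.2}

lemma commCount_congr {G : Type*} [Group G] {X Y X' Y' : Set G} (e : G × G ≃ G × G)
    (h : ∀ p, (p.1 ∈ X ∧ p.2 ∈ Y ∧ Commute p.1 p.2) ↔
      ((e p).1 ∈ X' ∧ (e p).2 ∈ Y' ∧ Commute (e p).1 (e p).2)) :
    commCount X Y = commCount X' Y' :=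
  Nat.card_congr (e.subtypeEquiv h)

lemma commCount_comm {G : Type*} [Group G] (X Y : Set G) : commCount X Y = commCount Y X :=
  commCount_congr (Equiv.prodComm G G) fun p => by
    simp only [Equiv.prodComm_apply, Prod.fst_swap, Prod.snd_swap, commute_iff_eq]
    tauto

/-- The number of commuting pairs, computed centralizer by centralizer. -/
lemma commCount_univ_right {G : Type*} [Group G] [Fintype G] (X : Set G) [DecidablePred (· ∈ X)] :
    commCount X Set.univ =
      ∑ x : G with x ∈ X, Nat.card (Subgroup.centralizer {x}) := by
  classical
  have e : {p : G × G // p.1 ∈ X ∧ p.2 ∈ Set.univ ∧ Commute p.1 p.2} ≃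
      Σ x : {x : G // x ∈ X}, Subgroup.centralizer {x.1} :=
    { toFun := fun p => ⟨⟨p.1.1, p.2.1⟩, ⟨p.1.2,
        Subgroup.mem_centralizer_singleton_iff.2 p.2.2.2.eq.symm⟩⟩
      invFun := fun s => ⟨(s.1.1, s.2.1), s.1.2, trivial,
        (Subgroup.mem_centralizer_singleton_iff.1 s.2.2).symm⟩
      left_inv := fun _ => rfl
      right_inv := fun _ => rfl }
  rw [commCount, Nat.card_congr e, Nat.card_sigma]
  exact (Finset.sum_subtype _ (by simp) (fun x => Nat.card (Subgroup.centralizer {x}))).symm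

lemma card_carrier_mul_card_centralizer {G : Type*} [Group G] [Finite G] (g : G) :
    Nat.card (ConjClasses.mk g).carrier * Nat.card (Subgroup.centralizer {g}) = Nat.card G := by
  rw [← ConjAct.orbit_eq_carrier_conjClasses, Nat.card_congr (ConjAct.toConjAct (G := G)).toEquiv,
    Nat.card_coe_set_eq, ← MulAction.index_stabilizer,
    ← (MulAction.stabilizer (ConjAct G) g).index_mul_card,
    ConjAct.stabilizer_eq_centralizer]
  rfl

/-- Burnside's count of the conjugacy classes inside a conjugation-invariant set. -/
lemma commCount_univ_eq_numClassesIn_mul {G : Type*} [Group G] [Finite G] (X : Set G)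
    (hX : ∀ x y : G, IsConj x y → x ∈ X → y ∈ X) :
    commCount X Set.univ = numClassesIn X * Nat.card G := by
  classical
  have := Fintype.ofFinite G
  rw [commCount_univ_right, numClassesIn, Set.ncard_eq_toFinset_card',
    ← Finset.sum_fiberwise_of_maps_to
      (t := {C : ConjClasses G | C.carrier ⊆ X}.toFinset) (g := ConjClasses.mk),
    Finset.sum_const_nat (m := Nat.card G)]
  · intro C hC
    induction C using Quotient.inductionOn with | _ g
    change (ConjClasses.mk g) ∈ _ at hC
    have hC : (ConjClasses.mk g).carrier ⊆ X := by simpa using hC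
    change ∑ x ∈ {x ∈ {x : G | x ∈ X} | ConjClasses.mk x = ConjClasses.mk g}, _ = _
    have hs : ({x ∈ ({x : G | x ∈ X} : Finset G) | ConjClasses.mk x = ConjClasses.mk g}) =
        (ConjClasses.mk g).carrier.toFinset := by
      ext x
      simp only [mem_filter, mem_univ, true_and, Set.mem_toFinset,
        ConjClasses.mem_carrier_iff_mk_eq, and_iff_right_iff_imp]
      exact fun h => hC (ConjClasses.mem_carrier_iff_mk_eq.2 h)
    have hpos : 0 < Nat.card (ConjClasses.mk g).carrier :=
      Nat.card_pos_iff.2 ⟨⟨⟨g, ConjClasses.mem_carrier_mk⟩⟩, inferInstance⟩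
    rw [hs, Finset.sum_const_nat (m := Nat.card (Subgroup.centralizer {g})),
      Set.toFinset_card, ← Nat.card_eq_fintype_card, card_carrier_mul_card_centralizer]
    intro x hx
    have hx : ConjClasses.mk x = ConjClasses.mk g := by
      simpa [ConjClasses.mem_carrier_iff_mk_eq] using hx
    have h1 := card_carrier_mul_card_centralizer x
    rw [hx, ← card_carrier_mul_card_centralizer g] at h1
    exact Nat.eq_of_mul_eq_mul_left hpos h1
  · intro x hx
    simp only [mem_filter, mem_univ, true_and] at hx
    simp only [Set.mem_toFinset, Set.mem_ofPred_eq]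
    intro y hy
    rw [ConjClasses.mem_carrier_iff_mk_eq, ConjClasses.mk_eq_mk_iff_isConj] at hy
    exact hX x y hy.symm hx

/-- A subgroup of a finite cyclic group consists of the elements whose order divides its order. -/
lemma mem_iff_orderOf_dvd_card {Q : Type*} [Group Q] [Finite Q] [IsCyclic Q] (A : Subgroup Q)
    (x : Q) : x ∈ A ↔ orderOf x ∣ Nat.card A := by
  classical
  have := Fintype.ofFinite Q
  have hs : ({x : Q | x ∈ A} : Finset Q) = ({x : Q | x ^ Nat.card A = 1} : Finset Q) := by
    -- In a cyclic group `x ^ m = 1` has at most `m` solutions, so with `m = |A|` the elements of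
    -- `A` exhaust them.
    refine Finset.eq_of_subset_of_card_le (fun x hx => ?_) ?_
    · simp only [mem_filter, mem_univ, true_and] at hx ⊢
      exact orderOf_dvd_iff_pow_eq_one.1 (A.orderOf_dvd_natCard hx)
    · refine (IsCyclic.card_pow_eq_one_le Nat.card_pos).trans ?_
      rw [Nat.card_eq_fintype_card, Fintype.card_subtype]
  rw [orderOf_dvd_iff_pow_eq_one]
  simpa using Finset.ext_iff.1 hs x

/-! ### Commuting pairs in a product of two cosets -/

section Cosets

variable {G : Type*} [Group G] (H : Subgroup G)

/-- The number of commuting pairs in the product of two cosets. -/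
noncomputable def cosetCommCount (α β : G ⧸ H) : ℕ :=
  commCount (cosetSet H α) (cosetSet H β)

lemma cosetCommCount_comm (α β : G ⧸ H) : cosetCommCount H α β = cosetCommCount H β α :=
  commCount_comm _ _

lemma commCount_preimage [Finite G] [Fintype (G ⧸ H)] (A B : G ⧸ H → Prop) [DecidablePred A]
    [DecidablePred B] :
    commCount {g : G | A (QuotientGroup.mk g)} {g : G | B (QuotientGroup.mk g)} =
      ∑ α : G ⧸ H with A α, ∑ β : G ⧸ H with B β, cosetCommCount H α β := by
  classical
  have := Fintype.ofFinite G
  have key (X Y : Set G) : commCount X Y =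
      #{p : G × G | p.1 ∈ X ∧ p.2 ∈ Y ∧ Commute p.1 p.2} := by
    rw [commCount, Nat.card_eq_fintype_card, Fintype.card_subtype]
  simp only [cosetCommCount, key]
  rw [← Finset.sum_product', Finset.card_eq_sum_card_fiberwise
    (f := fun p : G × G => ((p.1 : G ⧸ H), (p.2 : G ⧸ H)))
    (t := ({α : G ⧸ H | A α} : Finset _) ×ˢ ({β : G ⧸ H | B β} : Finset _))]
  · refine Finset.sum_congr rfl fun q hq => ?_
    congr 1
    obtain ⟨α, β⟩ := q
    simp only [mem_product, mem_filter, mem_univ, true_and] at hq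
    ext p
    simp only [mem_filter, mem_univ, true_and, Prod.mk.injEq]
    constructor
    · rintro ⟨⟨_, _, h⟩, h1, h2⟩
      exact ⟨h1, h2, h⟩
    · rintro ⟨h1, h2, h⟩
      refine ⟨⟨?_, ?_, h⟩, h1, h2⟩
      · exact (congrArg A h1).mpr hq.1
      · exact (congrArg B h2).mpr hq.2
  · intro p hp
    simp only [coe_filter, Set.mem_ofPred_eq, mem_univ, true_and] at hp
    simp [hp.1, hp.2.1]

variable [H.Normal]

/-- `x` commutes with `y` iff it commutes with `x * y`. This is one subtraction of the Euclidean
algorithm. -/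
lemma cosetCommCount_mul_right (α β : G ⧸ H) :
    cosetCommCount H α (α * β) = cosetCommCount H α β := by
  symm
  refine commCount_congr
    { toFun := fun p => (p.1, p.1 * p.2)
      invFun := fun p => (p.1, p.1⁻¹ * p.2)
      left_inv := fun p => by simp
      right_inv := fun p => by simp } fun p => ?_
  simp only [cosetSet, Set.mem_ofPred_eq, Equiv.coe_fn_mk, QuotientGroup.mk_mul, commute_iff_eq,
    mul_assoc, mul_right_inj]
  constructor
  · rintro ⟨h1, h2, h⟩
    exact ⟨h1, by rw [h1, h2], h⟩
  · rintro ⟨h1, h2, h⟩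
    rw [h1] at h2
    exact ⟨h1, mul_left_cancel h2, h⟩

lemma cosetCommCount_pow_mul_right (α β : G ⧸ H) (k : ℕ) :
    cosetCommCount H α (α ^ k * β) = cosetCommCount H α β := by
  induction k with
  | zero => simp
  | succ k ih => rw [pow_succ', mul_assoc, cosetCommCount_mul_right, ih]

/-- The Euclidean algorithm applied to a pair of powers. -/
lemma cosetCommCount_pow_pow (q : G ⧸ H) (i j : ℕ) :
    cosetCommCount H (q ^ i) (q ^ j) = cosetCommCount H (q ^ i.gcd j) 1 := by
  induction i, j using Nat.gcd.induction with
  | H0 n => rw [pow_zero, cosetCommCount_comm, Nat.gcd_zero_left]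
  | H1 m n _ ih =>
    rw [Nat.gcd_rec, ← ih, cosetCommCount_comm H (q ^ (n % m)),
      ← cosetCommCount_pow_mul_right H (q ^ m) (q ^ (n % m)) (n / m), ← pow_mul, ← pow_add,
      Nat.div_add_mod]

lemma orderOf_pow_gcd {Q : Type*} [Group Q] (q : Q) (i j : ℕ) :
    orderOf (q ^ i.gcd j) = (orderOf (q ^ i)).lcm (orderOf (q ^ j)) := by
  refine Nat.dvd_right_iff_eq.1 fun m => ?_
  rw [Nat.lcm_dvd_iff]
  simp only [orderOf_dvd_iff_pow_eq_one, ← pow_mul]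
  simp only [← orderOf_dvd_iff_pow_eq_one, ← Nat.dvd_gcd_iff, Nat.gcd_mul_right]

/-- The map `x ↦ x ^ k` is bijective on `G` and on `G ⧸ H`. Injectivity also lets commutation
descend from `x ^ k` to `x`, on comparing `x` with its conjugate by `y`. -/
lemma cosetCommCount_pow_coprime [Finite G] (γ : G ⧸ H) {k : ℕ} (hk : (Nat.card G).Coprime k) :
    cosetCommCount H (γ ^ k) 1 = cosetCommCount H γ 1 := by
  symm
  refine commCount_congr ((powCoprime hk).prodCongr (Equiv.refl G)) fun p => ?_
  have hinj : ∀ α β : G ⧸ H, α ^ k = β ^ k → α = β := fun α β h =>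
    (powCoprime (hk.coprime_dvd_left H.card_quotient_dvd_card)).injective h
  have hcomm : Commute (p.1 ^ k) p.2 ↔ Commute p.1 p.2 := by
    refine ⟨fun h => ?_, fun h => h.pow_left k⟩
    have h2 : (p.2 * p.1 * p.2⁻¹) ^ k = p.1 ^ k := by
      rw [conj_pow, ← h.eq, mul_inv_cancel_right]
    have h3 : p.2 * p.1 * p.2⁻¹ = p.1 := (powCoprime hk).injective h2
    exact (mul_inv_eq_iff_eq_mul.1 h3).symm
  simp only [cosetSet, Set.mem_ofPred_eq, Equiv.prodCongr_apply, Prod.map_fst, Prod.map_snd,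
    powCoprime_apply, Equiv.refl_apply, QuotientGroup.mk_pow, hcomm]
  refine and_congr_left fun _ => ⟨fun h => by rw [h], fun h => hinj _ _ h⟩

lemma cosetCommCount_one_eq_of_orderOf_eq [Finite G] [IsCyclic (G ⧸ H)] {γ δ : G ⧸ H}
    (h : orderOf γ = orderOf δ) : cosetCommCount H γ 1 = cosetCommCount H δ 1 := by
  have hz : δ ∈ Subgroup.zpowers γ := by
    rw [mem_iff_orderOf_dvd_card, Nat.card_zpowers, h]
  obtain ⟨m, rfl⟩ := (mem_powers_iff_mem_zpowers (x := γ)).2 hz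
  have hpos : 0 < orderOf γ := orderOf_pos γ
  have hcop : m.Coprime (orderOf γ) := by
    simp only [orderOf_pow] at h
    have hg := Nat.gcd_dvd_left (orderOf γ) m
    have h2 := Nat.div_mul_cancel hg
    rw [← h] at h2
    exact (Nat.gcd_comm _ _).trans ((Nat.mul_eq_left hpos.ne').1 h2)
  have hdvd : orderOf γ ∣ Nat.card G :=
    (orderOf_dvd_natCard γ).trans H.card_quotient_dvd_card
  -- `m` is prime to `orderOf γ` but perhaps not to `|G|`; lifting it to a unit modulo `|G|` leaves
  -- `γ ^ m` unchanged.
  obtain ⟨u, hu⟩ := ZMod.unitsMap_surjective hdvd (ZMod.unitOfCoprime m hcop)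
  have : NeZero (Nat.card G) := ⟨Nat.card_pos.ne'⟩
  have hk : (Nat.card G).Coprime (u : ZMod (Nat.card G)).val :=
    (ZMod.val_coe_unit_coprime u).symm
  have hmod : (u : ZMod (Nat.card G)).val ≡ m [MOD orderOf γ] := by
    rw [← ZMod.natCast_eq_natCast_iff]
    have := congrArg Units.val hu
    rw [ZMod.unitsMap_val, ZMod.coe_unitOfCoprime] at this
    rw [← this, ZMod.natCast_val]
  have : γ ^ m = γ ^ (u : ZMod (Nat.card G)).val := (pow_eq_pow_iff_modEq.2 hmod).symm
  change _ = cosetCommCount H (γ ^ m) 1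
  rw [this, cosetCommCount_pow_coprime H γ hk]

/-- The number of commuting pairs in a product of two cosets depends only on the order of the
subgroup that they generate. -/
lemma cosetCommCount_eq_of_orderOf_eq_lcm [Finite G] [IsCyclic (G ⧸ H)] {α β γ : G ⧸ H}
    (h : orderOf γ = (orderOf α).lcm (orderOf β)) :
    cosetCommCount H α β = cosetCommCount H γ 1 := by
  obtain ⟨q, hq⟩ := IsCyclic.exists_monoid_generator (α := G ⧸ H)
  obtain ⟨i, rfl⟩ := hq α
  obtain ⟨j, rfl⟩ := hq β
  change cosetCommCount H (q ^ i) (q ^ j) = _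
  rw [cosetCommCount_pow_pow]
  exact cosetCommCount_one_eq_of_orderOf_eq H ((orderOf_pow_gcd q i j).trans h.symm)

end Cosets

/-! ### Möbius inversion -/

section Arithmetic

open ArithmeticFunction

lemma sum_divisors_sum_moebius_mul (g : ℕ → ℚ) {e : ℕ} (he : 0 < e) :
    ∑ c ∈ e.divisors, ∑ a ∈ c.divisors, (moebius (c / a) : ℚ) * g a = g e := by
  refine sum_eq_iff_sum_mul_moebius_eq.2 (fun c _ => ?_) e he
  exact Nat.sum_divisorsAntidiagonal' (fun x y => (moebius x : ℚ) * g y)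

lemma sum_moebius_mul_sum_divisors (f : ℕ → ℚ) {c : ℕ} (hc : 0 < c) :
    ∑ b ∈ c.divisors, (moebius (c / b) : ℚ) * ∑ a ∈ b.divisors, f a = f c := by
  refine Eq.trans ?_ (sum_eq_iff_sum_mul_moebius_eq.1 (fun _ _ => rfl) c hc)
  exact (Nat.sum_divisorsAntidiagonal' (fun x y => (moebius x : ℚ) * ∑ a ∈ y.divisors, f a)).symm

/-- Möbius inversion over the multiples of a divisor of `n`. -/
lemma exists_eq_sum_multiples {n : ℕ} (hn : n ≠ 0) (p : ℕ → ℚ) :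
    ∃ r : ℕ → ℚ, ∀ k, k ∣ n → p k = ∑ e ∈ n.divisors with k ∣ e, r e := by
  -- The involution `e ↦ n / e` turns multiples of `k` into divisors of `n / k`, so ordinary
  -- inversion of `a ↦ p (n / a)` applies.
  refine ⟨fun e => ∑ a ∈ (n / e).divisors, (moebius (n / e / a) : ℚ) * p (n / a),
    fun k hk => ?_⟩
  have hk0 : 0 < k := Nat.pos_of_dvd_of_pos hk (Nat.pos_of_ne_zero hn)
  have h := sum_divisors_sum_moebius_mul (fun a => p (n / a))
    (Nat.div_pos (Nat.le_of_dvd (Nat.pos_of_ne_zero hn) hk) hk0)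
  simp only [Nat.div_div_self hk hn] at h
  rw [← h]
  refine Finset.sum_nbij' (fun c => n / c) (fun e => n / e) ?_ ?_ ?_ ?_ ?_
  · intro c hc
    obtain ⟨hc, -⟩ := Nat.mem_divisors.1 hc
    have hcn : c ∣ n := hc.trans (Nat.div_dvd_of_dvd hk)
    refine mem_filter.2 ⟨Nat.mem_divisors.2 ⟨Nat.div_dvd_of_dvd hcn, hn⟩, ?_⟩
    rwa [Nat.dvd_div_iff_mul_dvd hcn, mul_comm, ← Nat.dvd_div_iff_mul_dvd hk]
  · intro e he
    obtain ⟨he, hke⟩ := mem_filter.1 he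
    obtain ⟨he, -⟩ := Nat.mem_divisors.1 he
    refine Nat.mem_divisors.2 ⟨Nat.div_dvd_div_left he hke, ?_⟩
    exact (Nat.div_pos (Nat.le_of_dvd (Nat.pos_of_ne_zero hn) hk) hk0).ne'
  · intro c hc
    exact Nat.div_div_self ((Nat.mem_divisors.1 hc).1.trans (Nat.div_dvd_of_dvd hk)) hn
  · intro e he
    exact Nat.div_div_self (Nat.mem_divisors.1 (mem_filter.1 he).1).1 hn
  · intro c hc
    rw [Nat.div_div_self ((Nat.mem_divisors.1 hc).1.trans (Nat.div_dvd_of_dvd hk)) hn]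

lemma mul_gcd_div_lcm {e d : ℕ} (he : e ≠ 0) (hd : d ≠ 0) :
    (d : ℚ) * (e * ((e.gcd d : ℚ) / (e.lcm d : ℚ))) = (e.gcd d : ℚ) ^ 2 := by
  have h : (e.gcd d : ℚ) * (e.lcm d : ℚ) = e * d := by exact_mod_cast Nat.gcd_mul_lcm e d
  have hl : (e.lcm d : ℚ) ≠ 0 := by exact_mod_cast Nat.lcm_ne_zero he hd
  rw [← mul_div_assoc, ← mul_div_assoc, div_eq_iff hl, sq, mul_assoc, h]
  ring

end Arithmetic

/-! ### Sums over a cyclic group by element order -/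

section Cyclic

variable {Q : Type*} [Group Q] [Fintype Q] [IsCyclic Q]

lemma sum_orderOf_dvd {M : Type*} [AddCommMonoid M] (f : ℕ → M) {e : ℕ} (he : e ∣ Nat.card Q) :
    ∑ x : Q with orderOf x ∣ e, f (orderOf x) = ∑ c ∈ e.divisors, c.totient • f c := by
  have he0 : e ≠ 0 := ne_zero_of_dvd_ne_zero Nat.card_pos.ne' he
  rw [← Finset.sum_fiberwise_of_maps_to (t := e.divisors) (g := orderOf)]
  · refine Finset.sum_congr rfl fun c hc => ?_
    have hce := (Nat.mem_divisors.1 hc).1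
    rw [Finset.sum_congr rfl (g := fun _ => f c), Finset.sum_const, filter_filter,
      ← IsCyclic.card_orderOf_eq_totient (α := Q)
        (by rw [← Nat.card_eq_fintype_card]; exact hce.trans he)]
    · congr 2
      ext x
      simp only [mem_filter, mem_univ, true_and, and_iff_right_iff_imp]
      rintro rfl
      exact hce
    · intro x hx
      rw [(mem_filter.1 hx).2]
  · intro x hx
    exact Nat.mem_divisors.2 ⟨(mem_filter.1 hx).2, he0⟩

lemma card_orderOf_dvd {e : ℕ} (he : e ∣ Nat.card Q) : #{x : Q | orderOf x ∣ e} = e := by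
  rw [Finset.card_eq_sum_ones, sum_orderOf_dvd (fun _ => 1) he]
  simpa using Nat.sum_totient e

/-- Summing a function of the order of the subgroup generated by two elements, written in terms of
its Möbius inverse `r`. -/
lemma sum_sum_lcm_orderOf {p r : ℕ → ℚ}
    (hr : ∀ k, k ∣ Nat.card Q → p k = ∑ e ∈ (Nat.card Q).divisors with k ∣ e, r e)
    (A : Finset Q) {m : ℕ} (hm : m ∣ Nat.card Q) :
    ∑ α ∈ A, ∑ β : Q with orderOf β ∣ m, p ((orderOf α).lcm (orderOf β)) =
      ∑ e ∈ (Nat.card Q).divisors, (#{α ∈ A | orderOf α ∣ e} : ℚ) * (e.gcd m : ℚ) * r e := by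
  -- The condition `lcm ∣ e` splits into a product of two indicators, which separates `α` from `β`.
  have h1 (α β : Q) : p ((orderOf α).lcm (orderOf β)) = ∑ e ∈ (Nat.card Q).divisors,
      (if orderOf α ∣ e then 1 else 0) * (if orderOf β ∣ e then 1 else 0) * r e := by
    rw [hr _ (Nat.lcm_dvd (orderOf_dvd_natCard α) (orderOf_dvd_natCard β)), Finset.sum_filter]
    refine Finset.sum_congr rfl fun e _ => ?_
    simp only [Nat.lcm_dvd_iff]
    split_ifs <;> simp_all
  simp only [h1]
  rw [Finset.sum_congr rfl fun α _ => Finset.sum_comm, Finset.sum_comm]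
  refine Finset.sum_congr rfl fun e he => ?_
  have h2 : (e.gcd m : ℚ) = ∑ β : Q with orderOf β ∣ m, if orderOf β ∣ e then 1 else 0 := by
    rw [Finset.sum_boole, filter_filter]
    congr 1
    rw [← card_orderOf_dvd (Q := Q) ((Nat.gcd_dvd_right e m).trans hm)]
    congr 1
    ext x
    simp only [mem_filter, mem_univ, true_and, Nat.dvd_gcd_iff, and_comm]
  rw [h2, ← Finset.sum_boole, Finset.sum_mul_sum, Finset.sum_mul]
  exact Finset.sum_congr rfl fun α _ => (Finset.sum_mul _ _ _).symm

end Cyclic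

/-! ### Class numbers as sums over cosets -/

section Cosets

variable {G : Type*} [Group G] (H : Subgroup G) [H.Normal] [IsCyclic (G ⧸ H)]

/-- The quotient is cyclic, hence abelian, so each coset of `H` is a union of conjugacy classes. -/
lemma mk_eq_mk_of_isConj {x y : G} (h : IsConj x y) :
    (QuotientGroup.mk x : G ⧸ H) = QuotientGroup.mk y := by
  obtain ⟨c, rfl⟩ := isConj_iff.1 h
  simp only [QuotientGroup.mk_mul, QuotientGroup.mk_inv]
  rw [IsMulCommutative.is_comm.comm (QuotientGroup.mk c : G ⧸ H), mul_inv_cancel_right]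

variable [Finite G]

lemma mem_iff_orderOf_mk_dvd {L : Subgroup G} (hL : H ≤ L) (g : G) :
    g ∈ L ↔ orderOf (QuotientGroup.mk g : G ⧸ H) ∣ H.relIndex L := by
  have h : Nat.card (L.map (QuotientGroup.mk' H)) = H.relIndex L := by
    rw [← Subgroup.relIndex_ker, QuotientGroup.ker_mk']
  rw [← h, ← mem_iff_orderOf_dvd_card]
  have : g ∈ (L.map (QuotientGroup.mk' H)).comap (QuotientGroup.mk' H) ↔ g ∈ L := by
    rw [Subgroup.comap_map_eq_self (by rwa [QuotientGroup.ker_mk'])]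
  exact this.symm

lemma commCount_subgroup {G : Type*} [Group G] (L : Subgroup G) :
    commCount (L : Set G) L = Nat.card (ConjClasses L) * Nat.card L := by
  rw [← card_comm_eq_card_conjClasses_mul_card]
  exact Nat.card_congr
    { toFun := fun p => ⟨(⟨p.1.1, p.2.1⟩, ⟨p.1.2, p.2.2.1⟩), Subtype.ext p.2.2.2⟩
      invFun := fun p => ⟨(p.1.1, p.1.2), p.1.1.2, p.1.2.2, congrArg Subtype.val p.2⟩
      left_inv := fun _ => rfl
      right_inv := fun _ => rfl }

variable [Fintype (G ⧸ H)]

lemma numClassesIn_cosetSet_mul (α : G ⧸ H) :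
    numClassesIn (cosetSet H α) * Nat.card G = ∑ β : G ⧸ H, cosetCommCount H α β := by
  classical
  rw [← commCount_univ_eq_numClassesIn_mul]
  · have := commCount_preimage H (fun γ => γ = α) (fun _ => True)
    simp only [filter_eq', mem_univ, if_true, sum_singleton, filter_true] at this
    exact this
  · intro x y h hx
    exact (mk_eq_mk_of_isConj H h).symm.trans hx

lemma numClassesIn_subgroup {L : Subgroup G} (hL : H ≤ L) :
    numClassesIn (L : Set G) =
      ∑ α : G ⧸ H with orderOf α ∣ H.relIndex L, numClassesIn (cosetSet H α) := by
  classical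
  refine Nat.eq_of_mul_eq_mul_right (Nat.card_pos (α := G)) ?_
  rw [Finset.sum_mul, Finset.sum_congr rfl fun α _ => numClassesIn_cosetSet_mul H α,
    ← commCount_univ_eq_numClassesIn_mul]
  · have h := commCount_preimage H (fun α => orderOf α ∣ H.relIndex L) (fun _ => True)
    simp only [← mem_iff_orderOf_mk_dvd H hL] at h
    simpa using h
  · intro x y h hx
    rw [SetLike.mem_coe, mem_iff_orderOf_mk_dvd H hL] at hx ⊢
    rwa [← mk_eq_mk_of_isConj H h]

lemma card_conjClasses_subgroup_mul {L : Subgroup G} (hL : H ≤ L) :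
    Nat.card (ConjClasses L) * Nat.card L =
      ∑ α : G ⧸ H with orderOf α ∣ H.relIndex L, ∑ β : G ⧸ H with orderOf β ∣ H.relIndex L,
        cosetCommCount H α β := by
  classical
  rw [← commCount_subgroup]
  have h := commCount_preimage H (fun α => orderOf α ∣ H.relIndex L)
    (fun α => orderOf α ∣ H.relIndex L)
  simp only [← mem_iff_orderOf_mk_dvd H hL] at h
  exact h

end Cosets

theorem theorem3 {G : Type*} [Group G] [Finite G] (H : Subgroup G) [H.Normal]
    [IsCyclic (G ⧸ H)] (n : ℕ) (hn : n = Nat.card (G ⧸ H))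
    -- `K c` is the subgroup of `G` that contains `H` with index `c`
    (K : ℕ → Subgroup G) (hHK : ∀ c, c ∣ n → H ≤ K c)
    (hK : ∀ c, c ∣ n → H.relIndex (K c) = c)
    -- `Γ c` is any coset of order `c` in `G ⧸ H`
    (Γ : ℕ → G ⧸ H) (hΓ : ∀ c, c ∣ n → orderOf (Γ c) = c)
    (d : ℕ) (hd : d ∣ n) :
    (Nat.card (ConjClasses (K d)) : ℚ) =
        n * ∑ c ∈ n.divisors, ∑ a ∈ c.divisors,
          (ArithmeticFunction.moebius (c / a) : ℚ) *
            ((Nat.gcd a d : ℚ) / (Nat.lcm a d : ℚ)) * (numClassesIn (cosetSet H (Γ c)) : ℚ) ∧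
    (Nat.card (ConjClasses (K d)) : ℚ) =
        n * ∑ c ∈ n.divisors, ∑ a ∈ c.divisors, ∑ b ∈ c.divisors,
          ((ArithmeticFunction.moebius (c / a) : ℚ) * (ArithmeticFunction.moebius (c / b) : ℚ) /
              (Nat.totient c : ℚ)) *
            ((Nat.gcd a d : ℚ) / (Nat.lcm a d : ℚ)) * (numClassesIn (K b : Set G) : ℚ) := by
  classical
  have := Fintype.ofFinite (G ⧸ H)
  have hn0 : n ≠ 0 := hn ▸ Nat.card_pos.ne'
  have hd0 : d ≠ 0 := ne_zero_of_dvd_ne_zero hn0 hd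
  have hH0 : (Nat.card H : ℚ) ≠ 0 := Nat.cast_ne_zero.2 Nat.card_pos.ne'
  obtain ⟨r, hr⟩ := exists_eq_sum_multiples hn0 fun k => (cosetCommCount H (Γ k) 1 : ℚ)
  have hP (α β : G ⧸ H) : cosetCommCount H α β =
      cosetCommCount H (Γ ((orderOf α).lcm (orderOf β))) 1 :=
    cosetCommCount_eq_of_orderOf_eq_lcm H (hΓ _ (hn ▸ Nat.lcm_dvd (orderOf_dvd_natCard α)
      (orderOf_dvd_natCard β)))
  have hT (α : G ⧸ H) : (n * Nat.card H : ℚ) * numClassesIn (cosetSet H α) =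
      ∑ e ∈ n.divisors with orderOf α ∣ e, (e : ℚ) * r e := by
    have h := numClassesIn_cosetSet_mul H α
    rw [Subgroup.card_eq_card_quotient_mul_card_subgroup H, ← hn] at h
    have h' := sum_sum_lcm_orderOf (Q := G ⧸ H) (hn ▸ hr) {α} (dvd_refl (Nat.card (G ⧸ H)))
    simp only [sum_singleton, ← hP, filter_true_of_mem fun β _ => orderOf_dvd_natCard β] at h'
    rw [← hn] at h'
    rw [mul_comm, ← Nat.cast_mul, ← Nat.cast_mul, h, Nat.cast_sum, h', Finset.sum_filter]
    refine Finset.sum_congr rfl fun e he => ?_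
    rw [Nat.gcd_eq_left (Nat.mem_divisors.1 he).1, filter_singleton]
    split_ifs <;> simp
  have hS : (d * Nat.card H : ℚ) * Nat.card (ConjClasses (K d)) =
      ∑ e ∈ n.divisors, (e.gcd d : ℚ) ^ 2 * r e := by
    have h := card_conjClasses_subgroup_mul H (hHK d hd)
    have hc : Nat.card (K d) = d * Nat.card H := by
      rw [← Subgroup.relIndex_bot_left, ← Subgroup.relIndex_bot_left,
        ← Subgroup.relIndex_mul_relIndex ⊥ H (K d) bot_le (hHK d hd), hK d hd, mul_comm]
    rw [hK d hd, hc] at h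
    have h' := sum_sum_lcm_orderOf (Q := G ⧸ H) (hn ▸ hr) {α | orderOf α ∣ d} (hn ▸ hd)
    simp only [← hP, ← hn] at h'
    rw [mul_comm, ← Nat.cast_mul, ← Nat.cast_mul, h]
    push_cast
    rw [h']
    refine Finset.sum_congr rfl fun e he => ?_
    have hg := card_orderOf_dvd (Q := G ⧸ H) (hn ▸ (Nat.gcd_dvd_right e d).trans hd)
    simp only [Nat.dvd_gcd_iff, and_comm] at hg
    rw [filter_filter, hg, sq]
  -- The right side of `hT` sees `α` only through its order.
  have hTΓ (α : G ⧸ H) : numClassesIn (cosetSet H α) =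
      numClassesIn (cosetSet H (Γ (orderOf α))) := by
    have h : (n * Nat.card H : ℚ) * numClassesIn (cosetSet H α) =
        (n * Nat.card H : ℚ) * numClassesIn (cosetSet H (Γ (orderOf α))) := by
      rw [hT, hT, hΓ _ (hn ▸ orderOf_dvd_natCard α)]
    exact_mod_cast mul_left_cancel₀ (mul_ne_zero (Nat.cast_ne_zero.2 hn0) hH0) h
  have first : (Nat.card (ConjClasses (K d)) : ℚ) =
      n * ∑ c ∈ n.divisors, ∑ a ∈ c.divisors, (ArithmeticFunction.moebius (c / a) : ℚ) *
        ((Nat.gcd a d : ℚ) / (Nat.lcm a d : ℚ)) * (numClassesIn (cosetSet H (Γ c)) : ℚ) := by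
    refine mul_left_cancel₀ (mul_ne_zero (Nat.cast_ne_zero.2 hd0) hH0) (hS.trans ?_)
    -- `F` is the Möbius inverse of `a ↦ gcd(a, d) / lcm(a, d)`; exchanging the sums over `c` and
    -- `e` sums it over the divisors of `e`.
    set F : ℕ → ℚ := fun c => ∑ a ∈ c.divisors, (ArithmeticFunction.moebius (c / a) : ℚ) *
        ((Nat.gcd a d : ℚ) / (Nat.lcm a d : ℚ))
    have hcT : ∀ c ∈ n.divisors, (n * Nat.card H : ℚ) * (∑ a ∈ c.divisors,
        (ArithmeticFunction.moebius (c / a) : ℚ) * ((Nat.gcd a d : ℚ) / (Nat.lcm a d : ℚ)) *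
          (numClassesIn (cosetSet H (Γ c)) : ℚ)) =
        ∑ e ∈ n.divisors, if c ∣ e then F c * (e * r e) else 0 := by
      intro c hc
      rw [← Finset.sum_mul, mul_left_comm, hT, hΓ c (Nat.mem_divisors.1 hc).1, Finset.mul_sum,
        Finset.sum_filter]
    have : (d * Nat.card H : ℚ) * (n * ∑ c ∈ n.divisors, ∑ a ∈ c.divisors,
        (ArithmeticFunction.moebius (c / a) : ℚ) * ((Nat.gcd a d : ℚ) / (Nat.lcm a d : ℚ)) *
          (numClassesIn (cosetSet H (Γ c)) : ℚ)) = d * ((n * Nat.card H : ℚ) *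
        ∑ c ∈ n.divisors, ∑ a ∈ c.divisors, (ArithmeticFunction.moebius (c / a) : ℚ) *
        ((Nat.gcd a d : ℚ) / (Nat.lcm a d : ℚ)) * (numClassesIn (cosetSet H (Γ c)) : ℚ)) := by
      ring
    rw [this, Finset.mul_sum _ _ (n * Nat.card H : ℚ), Finset.sum_congr rfl hcT, Finset.sum_comm,
      Finset.mul_sum]
    refine Finset.sum_congr rfl fun e he => ?_
    have hen := (Nat.mem_divisors.1 he).1
    have he0 : e ≠ 0 := ne_zero_of_dvd_ne_zero hn0 hen
    have hsum : ∑ c ∈ e.divisors, F c = (Nat.gcd e d : ℚ) / (Nat.lcm e d : ℚ) :=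
      sum_divisors_sum_moebius_mul (fun a => (Nat.gcd a d : ℚ) / (Nat.lcm a d : ℚ))
        (Nat.pos_of_ne_zero he0)
    rw [← Finset.sum_filter, ← Finset.sum_mul, Nat.divisors_filter_dvd_of_dvd hn0 hen, hsum,
      ← mul_gcd_div_lcm he0 hd0]
    ring
  refine ⟨first, first.trans ?_⟩
  congr 1
  refine Finset.sum_congr rfl fun c hc => Finset.sum_congr rfl fun a _ => ?_
  have hcn := (Nat.mem_divisors.1 hc).1
  have hc0 : 0 < c := Nat.pos_of_dvd_of_pos hcn (Nat.pos_of_ne_zero hn0)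
  have hφ : (c.totient : ℚ) ≠ 0 := Nat.cast_ne_zero.2 (Nat.totient_pos.2 hc0).ne'
  have hb : ∀ b ∈ c.divisors, (numClassesIn (K b : Set G) : ℚ) =
      ∑ k ∈ b.divisors, (k.totient : ℚ) * numClassesIn (cosetSet H (Γ k)) := by
    intro b hb
    have hbn := (Nat.mem_divisors.1 hb).1.trans hcn
    rw [numClassesIn_subgroup H (hHK b hbn), hK b hbn, Finset.sum_congr rfl fun α _ => hTΓ α,
      sum_orderOf_dvd (fun k => numClassesIn (cosetSet H (Γ k))) (hn ▸ hbn)]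
    push_cast [smul_eq_mul]
    rfl
  -- Inversion of `hb` expresses `φ(c) T_c` through the `S_b`; division by `φ(c)` then eliminates
  -- `T_c`.
  have hinv := sum_moebius_mul_sum_divisors
    (fun k => (k.totient : ℚ) * numClassesIn (cosetSet H (Γ k))) hc0
  rw [Finset.sum_congr rfl fun b h => congrArg _ (hb b h).symm] at hinv
  rw [eq_div_of_mul_eq hφ ((mul_comm _ _).trans hinv.symm), Finset.sum_div, Finset.mul_sum]
  refine Finset.sum_congr rfl fun b _ => ?_
  ring
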